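/- **Setting.** Let $n,t\in\mathbb N$. For $d\in\mathbb N$ identify the space $\mathbb R[\mathbf x]_{d}$ of real polynomials in $\mathbf x=(x_1,\dots,x_n)$ of degree at most $d$ with $\mathbb R^{s(d)}$, $s(d)=\binom{n+d}{n}$, through coefficients, and identify a functional $\phi\in\mathbb R[\mathbf x]_{2t}^*$ with its moment vector $\boldsymbol\phi=(\phi(\mathbf x^{\alpha}))_{|\alpha|\le 2t}\in\mathbb R^{s(2t)}$. Let $\Sigma_d\subset\mathbb R[\mathbf x]_{2d}$ be the cone of sums of squares of polynomials that have degree at most $2d$; $\mathrm{int}(\Sigma_d)$ is its interior in $\mathbb R[\mathbf x]_{2d}$. Let $\mathbf v_d(\mathbf x)=(\mathbf x^\alpha)_{|\alpha|\le d}$. Let $0\neq g\in\mathbb R[\mathbf x]$ have even degree, $t_g=\lceil\deg(g)/2\rceil\le t$, and suppose that $\{\mathbf x\in\mathbb R^n: g(\mathbf x)\ge 0\}$ has nonempty interior. Let $$Q_t(G)=\{\sigma_0+\sigma_1 g:\ \sigma_0,\sigma_1\ \text{sums of squares},\ \deg\sigma_0\le 2t,\ \deg(\sigma_1 g)\le 2t\},\qquad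 G=\{g\},$$ and let $Q_t(G)^*=\{\boldsymbol\phi\in\mathbb R^{s(2t)}:\ \phi(h)\ge 0\ \ \forall h\in Q_t(G)\}$, with interior taken in $\mathbb R^{s(2t)}$. For $\phi\in\mathbb R[\mathbf x]_{2t}^*$ let $\mathbf M_t(\phi)=(\phi(\mathbf x^{\alpha+\beta}))_{|\alpha|,|\beta|\le t}$ and $\mathbf M_{t-t_g}(g\cdot\phi)=(\phi(g\,\mathbf x^{\alpha+\beta}))_{|\alpha|,|\beta|\le t-t_g}$. When these matrices are positive definite, the associated Christoffel polynomials are $$\Lambda^{\phi}_t(\mathbf x)^{-1}=\mathbf v_t(\mathbf x)^T\mathbf M_t(\phi)^{-1}\mathbf v_t(\mathbf x),\qquad \Lambda^{g\cdot\phi}_{t-t_g}(\mathbf x)^{-1}=\mathbf v_{t-t_g}(\mathbf x)^T\mathbf M_{t-t_g}(g\cdot\phi)^{-1}\mathbf v_{t-t_g}(\mathbf x).$$ **Lemma (label reverse).** (a) If there are $p\in\mathrm{int}(\Sigma_t)$ and $q\in\mathrm{int}(\Sigma_{t-t_g})$ with $p+g\,q=1$, then there is a linear functional $\phi\in\mathbb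 R[\mathbf x]_{2t}^*$ with $\boldsymbol\phi\in\mathrm{int}(Q_t(G)^*)$ such that $\mathbf M_t(\phi)$ and $\mathbf M_{t-t_g}(g\cdot\phi)$ are positive definite and $$1=\Lambda^{\phi}_t(\mathbf x)^{-1}+g(\mathbf x)\,\Lambda^{g\cdot\phi}_{t-t_g}(\mathbf x)^{-1}\qquad\text{for all }\mathbf x\in\mathbb R^n.\tag{$*$}$$ (b) In particular, if $(C_i,H_i)_{i\in I}\subset\mathbb Z[\mathbf x]$ is a finite family of solutions of the polynomial Pell equations $C_i^2+g\,H_i^2=1$, $i\in I$, with $\sum_{i\in I}C_i^2\in\mathrm{int}(\Sigma_t)$ and $\sum_{i\in I}H_i^2\in\mathrm{int}(\Sigma_{t-t_g})$, then there is likewise a functional $\phi\in\mathbb R[\mathbf x]_{2t}^*$ with $\boldsymbol\phi\in\mathrm{int}(Q_t(G)^*)$ for which both matrices are positive definite and $(*)$ holds. -/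

import Mathlib

open MvPolynomial
open scoped Matrix

noncomputable section

namespace Pell

/-- The exponents `α ∈ ℕⁿ` with `|α| ≤ d`; they index the monomials of degree at most `d`. -/
abbrev Idx (n d : ℕ) : Type := {α : Fin n →₀ ℕ // α.degree ≤ d}

instance instFiniteIdx (n d : ℕ) : Finite (Idx n d) :=
  (Finsupp.finite_of_degree_le d).to_subtype

instance instFintypeIdx (n d : ℕ) : Fintype (Idx n d) := Fintype.ofFinite _

/-- The vector `(p_α)_{|α| ≤ d}` of coefficients of `p`. It identifies `ℝ[x]_d` with
`ℝ^{s(d)}`. -/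
def coeffVec {n : ℕ} (d : ℕ) (p : MvPolynomial (Fin n) ℝ) : Idx n d → ℝ :=
  fun α => p.coeff α.1

/-- The cone `Σ[x]_t` of sums of squares of degree at most `2t`. -/
def sosCone (n t : ℕ) : Set (MvPolynomial (Fin n) ℝ) :=
  {p | IsSumSq p ∧ p.totalDegree ≤ 2 * t}

/-- `int(Σ[x]_t)`: the interior of `Σ[x]_t` in the finite-dimensional space `ℝ[x]_{2t}`,
whose topology is that of `ℝ^{s(2t)}`. -/
def intSosCone (n t : ℕ) : Set (MvPolynomial (Fin n) ℝ) :=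
  {p | p.totalDegree ≤ 2 * t ∧ coeffVec (2 * t) p ∈ interior (coeffVec (2 * t) '' sosCone n t)}

/-- `t_g = ⌈deg(g) / 2⌉`. -/
def halfDeg {n : ℕ} (g : MvPolynomial (Fin n) ℝ) : ℕ := (g.totalDegree + 1) / 2

/-- The `2t`-truncated quadratic module `Q_t(G)` of the single generator `g`
(the constant generator `g₀ = 1` is always present). -/
def truncQuadModule {n : ℕ} (t : ℕ) (g : MvPolynomial (Fin n) ℝ) :
    Set (MvPolynomial (Fin n) ℝ) :=
  {h | ∃ σ₀ σ₁ : MvPolynomial (Fin n) ℝ, IsSumSq σ₀ ∧ IsSumSq σ₁ ∧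
    σ₀.totalDegree ≤ 2 * t ∧ (σ₁ * g).totalDegree ≤ 2 * t ∧ h = σ₀ + σ₁ * g}

/-- The Riesz functional `p ↦ ∑_α p_α φ_α` of a finite sequence `φ = (φ_α)_{|α| ≤ d}`.
It is the functional on `ℝ[x]_d` with moments `φ`, and is extended to all
polynomials by zero on the monomials of degree larger than `d`. -/
def riesz {n d : ℕ} (φ : Idx n d → ℝ) : MvPolynomial (Fin n) ℝ →ₗ[ℝ] ℝ :=
  ∑ α : Idx n d, φ α • MvPolynomial.lcoeff ℝ α.1

/-- The functional `g · L`, given by `(g · L)(p) = L(g p)`. -/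
def localize {n : ℕ} (g : MvPolynomial (Fin n) ℝ) (L : MvPolynomial (Fin n) ℝ →ₗ[ℝ] ℝ) :
    MvPolynomial (Fin n) ℝ →ₗ[ℝ] ℝ :=
  L ∘ₗ LinearMap.mulLeft ℝ g

/-- The moment matrix `M_s(L)`, with entries `L(x^{α+β})` for `|α|, |β| ≤ s`. -/
def momentMatrix {n : ℕ} (s : ℕ) (L : MvPolynomial (Fin n) ℝ →ₗ[ℝ] ℝ) :
    Matrix (Idx n s) (Idx n s) ℝ :=
  Matrix.of fun α β => L (monomial (α.1 + β.1) 1)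

/-- The vector `v_s(x) = (x^α)_{|α| ≤ s}` of monomials. -/
def monVec {n : ℕ} (s : ℕ) (x : Fin n → ℝ) : Idx n s → ℝ :=
  fun α => eval x (monomial α.1 (1 : ℝ))

/-- The Christoffel polynomial `x ↦ Λ_s^L(x)⁻¹ = v_s(x)ᵀ M_s(L)⁻¹ v_s(x)`, the reciprocal of
the degree-`s` Christoffel function (meaningful when `M_s(L)` is positive definite). -/
def christoffelPoly {n : ℕ} (s : ℕ) (L : MvPolynomial (Fin n) ℝ →ₗ[ℝ] ℝ) (x : Fin n → ℝ) : ℝ :=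
  monVec s x ⬝ᵥ ((momentMatrix s L)⁻¹ *ᵥ monVec s x)

/-- The dual cone `Q_t(G)^*`, as a set of moment vectors in `ℝ^{s(2t)}`. -/
def dualCone {n : ℕ} (t : ℕ) (g : MvPolynomial (Fin n) ℝ) : Set (Idx n (2 * t) → ℝ) :=
  {φ | ∀ h ∈ truncQuadModule t g, 0 ≤ riesz φ h}

end Pell

end

noncomputable section

namespace Pell

open Filter Topology

/-! ### Maximizing a product of determinants -/

section Matrix

variable {ι κ : Type*} [Fintype ι] [Fintype κ]

/-! Write A(φ) for the moment matrix and B(φ) for the matrix localized at g. Maximize det A(φ) · det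
B(φ) over the φ with φ(1) = 1 and both matrices positive semidefinite. This slice is compact: p + gq
= c gives φ(p) ≤ c, and since p is interior this bounds every moment (`isBounded_setOf_posSemidef`).
Sums of Dirac measures on a grid in {g ≥ 0} make the maximum positive
(`exists_posDef_momentMatrix`), so both matrices are definite at a maximizer.

The Lagrange condition, after rescaling φ, reads tr(A(φ)⁻¹A(ψ)) + tr(B(φ)⁻¹B(ψ)) = ψ(1) for all ψ
(`exists_posDef_trace_eq`). For ψ the Dirac moments at x, A(ψ) and B(ψ) have rank at most one and
this is exactly (*). The certificate p + gq = c serves only for compactness, so any constant c will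
do; summing Pell equations gives c = |I|. -/

theorem isOpen_setOf_posDef {E : Type*} [TopologicalSpace E] {A : E → Matrix ι ι ℝ}
    (hA : Continuous A) (hs : ∀ x, (A x).IsHermitian) : IsOpen {x | (A x).PosDef} := by
  have key : ∀ x, (A x).PosDef ↔ ∀ v ∈ Metric.sphere (0 : ι → ℝ) 1, 0 < v ⬝ᵥ A x *ᵥ v := by
    intro x
    constructor
    · intro h v hv
      have hv0 : v ≠ 0 := by
        rintro rfl
        simp at hv
      simpa using h.dotProduct_mulVec_pos hv0
    · intro h
      refine Matrix.PosDef.of_dotProduct_mulVec_pos (hs x) fun v hv => ?_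
      have hn : 0 < ‖v‖ := norm_pos_iff.2 hv
      have := h (‖v‖⁻¹ • v) (by simp [norm_smul, hn.ne'])
      rw [Matrix.mulVec_smul, dotProduct_smul, smul_dotProduct, smul_smul, smul_eq_mul] at this
      simpa using (mul_pos_iff_of_pos_left (by positivity)).1 this
  simp_rw [key]
  -- Compactness of the sphere turns pointwise strict positivity into an open condition on x.
  rw [isOpen_iff_eventually]
  intro x hx
  refine (isCompact_sphere (0 : ι → ℝ) 1).eventually_forall_of_forall_eventually fun v hv => ?_
  have hc : Continuous fun z : E × (ι → ℝ) => z.2 ⬝ᵥ A z.1 *ᵥ z.2 := by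
    exact continuous_snd.dotProduct ((hA.comp continuous_fst).matrix_mulVec continuous_snd)
  exact hc.continuousAt.eventually (lt_mem_nhds (hx v hv))

theorem isClosed_setOf_posSemidef {E : Type*} [TopologicalSpace E] {A : E → Matrix ι ι ℝ}
    (hA : Continuous A) (hs : ∀ x, (A x).IsHermitian) : IsClosed {x | (A x).PosSemidef} := by
  have : {x | (A x).PosSemidef} = ⋂ v : ι → ℝ, {x | 0 ≤ v ⬝ᵥ A x *ᵥ v} := by
    ext x
    simp only [Set.mem_ofPred_eq, Set.mem_iInter]
    exact ⟨fun h v => by simpa using h.dotProduct_mulVec_nonneg v,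
      fun h => .of_dotProduct_mulVec_nonneg (hs x) fun v => by simpa using h v⟩
  rw [this]
  exact isClosed_iInter fun v => isClosed_le continuous_const
    (continuous_const.dotProduct (hA.matrix_mulVec continuous_const))

variable [DecidableEq ι] [DecidableEq κ]

/-- Jacobi's formula: factor out A, then the linear term of det(1 + sM) is tr M. -/
theorem hasDerivAt_det_add_smul {A : Matrix ι ι ℝ} (hA : IsUnit A.det) (B : Matrix ι ι ℝ) :
    HasDerivAt (fun s : ℝ => (A + s • B).det) (A.det * (A⁻¹ * B).trace) 0 := by
  have h : ∀ s : ℝ, (A + s • B).det = A.det * (1 + s • (A⁻¹ * B)).det := by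
    intro s
    rw [← Matrix.det_mul, mul_add, mul_one, Matrix.mul_smul, Matrix.mul_nonsing_inv_cancel_left _ _ hA]
  simp_rw [h]
  refine HasDerivAt.const_mul _ ?_
  generalize A⁻¹ * B = M
  have h1 := (Matrix.det (1 + (Polynomial.X : Polynomial ℝ) •
    M.map Polynomial.C)).hasDerivAt 0
  rw [Matrix.derivative_det_one_add_X_smul] at h1
  refine h1.congr_of_eventuallyEq (.of_forall fun s => ?_)
  change (1 + s • M).det = Polynomial.eval s _
  rw [← Polynomial.coe_evalRingHom, RingHom.map_det]
  congr 1
  ext i j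
  simp [Matrix.one_apply, apply_ite]
  ring

/-- A positive definite critical point of `det A · det B` on the affine hyperplane `ℓ = 1`,
rescaled so that the Lagrange multiplier is one. -/
theorem exists_posDef_trace_eq [Nonempty ι] {E : Type*} [NormedAddCommGroup E] [NormedSpace ℝ E]
    [FiniteDimensional ℝ E] (A : E →ₗ[ℝ] Matrix ι ι ℝ) (B : E →ₗ[ℝ] Matrix κ κ ℝ) (ℓ : E →ₗ[ℝ] ℝ)
    (hA : ∀ φ, (A φ).IsHermitian) (hB : ∀ φ, (B φ).IsHermitian)
    (hbd : Bornology.IsBounded {φ | (A φ).PosSemidef ∧ (B φ).PosSemidef ∧ ℓ φ = 1})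
    {φ₀ : E} (hA₀ : (A φ₀).PosDef) (hB₀ : (B φ₀).PosDef) (hℓ : 0 < ℓ φ₀) :
    ∃ φ, (A φ).PosDef ∧ (B φ).PosDef ∧
      ∀ ψ, ((A φ)⁻¹ * A ψ).trace + ((B φ)⁻¹ * B ψ).trace = ℓ ψ := by
  have hAc : Continuous A := A.continuous_of_finiteDimensional
  have hBc : Continuous B := B.continuous_of_finiteDimensional
  have hℓc : Continuous ℓ := ℓ.continuous_of_finiteDimensional
  set K := {φ | (A φ).PosSemidef ∧ (B φ).PosSemidef ∧ ℓ φ = 1} with hK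
  have hKc : IsCompact K := Metric.isCompact_of_isClosed_isBounded
    ((isClosed_setOf_posSemidef hAc hA).inter ((isClosed_setOf_posSemidef hBc hB).inter
      (isClosed_eq hℓc continuous_const))) hbd
  have hA₁ : (A ((ℓ φ₀)⁻¹ • φ₀)).PosDef := by
    rw [map_smul]; exact hA₀.smul (inv_pos.2 hℓ)
  have hB₁ : (B ((ℓ φ₀)⁻¹ • φ₀)).PosDef := by
    rw [map_smul]; exact hB₀.smul (inv_pos.2 hℓ)
  have hmem : (ℓ φ₀)⁻¹ • φ₀ ∈ K :=
    ⟨hA₁.posSemidef, hB₁.posSemidef, by simp [hℓ.ne']⟩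
  obtain ⟨φ, ⟨hAφ, hBφ, hℓφ⟩, hmax⟩ := hKc.exists_isMaxOn ⟨_, hmem⟩
    (f := fun φ => (A φ).det * (B φ).det) (hAc.matrix_det.mul hBc.matrix_det).continuousOn
  -- The maximum is at least the value at a definite point, so neither determinant vanishes and the
  -- semidefinite maximizer is definite.
  have hpos : 0 < (A φ).det * (B φ).det :=
    (mul_pos hA₁.det_pos hB₁.det_pos).trans_le (hmax hmem)
  have hdA : 0 < (A φ).det := hAφ.det_nonneg.lt_of_ne' (left_ne_zero_of_mul hpos.ne')
  have hdB : 0 < (B φ).det := hBφ.det_nonneg.lt_of_ne' (right_ne_zero_of_mul hpos.ne')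
  have hPA : (A φ).PosDef :=
    hAφ.posDef_iff_isUnit.2 ((Matrix.isUnit_iff_isUnit_det _).2 hdA.ne'.isUnit)
  have hPB : (B φ).PosDef :=
    hBφ.posDef_iff_isUnit.2 ((Matrix.isUnit_iff_isUnit_det _).2 hdB.ne'.isUnit)
  set T : E → ℝ := fun ψ => ((A φ)⁻¹ * A ψ).trace + ((B φ)⁻¹ * B ψ).trace with hT
  have hcrit : ∀ ψ, ℓ ψ = 0 → T ψ = 0 := by
    intro ψ hψ
    have hline : Continuous fun s : ℝ => φ + s • ψ := by fun_prop
    have hev : ∀ᶠ s : ℝ in 𝓝 0, φ + s • ψ ∈ K := by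
      have h1 := ((isOpen_setOf_posDef hAc hA).preimage hline).mem_nhds (x := 0) (by simpa)
      have h2 := ((isOpen_setOf_posDef hBc hB).preimage hline).mem_nhds (x := 0) (by simpa)
      filter_upwards [h1, h2] with s h1 h2
      exact ⟨Matrix.PosDef.posSemidef h1, Matrix.PosDef.posSemidef h2, by simp [hψ, hℓφ]⟩
    have hd := (hasDerivAt_det_add_smul hdA.ne'.isUnit (A ψ)).mul
      (hasDerivAt_det_add_smul hdB.ne'.isUnit (B ψ))
    have hloc : IsLocalMax ((fun s : ℝ => (A φ + s • A ψ).det) *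
        fun s : ℝ => (B φ + s • B ψ).det) 0 := by
      filter_upwards [hev] with s hs
      simpa using hmax hs
    have h0 := hloc.hasDerivAt_eq_zero hd
    simp only [zero_smul, add_zero] at h0
    have : (A φ).det * (B φ).det * T ψ = 0 := by
      rw [← h0, hT]; ring
    exact (mul_eq_zero.1 this).resolve_left hpos.ne'
  have hTφ : T φ = Fintype.card ι + Fintype.card κ := by
    simp [hT, Matrix.nonsing_inv_mul _ hdA.ne'.isUnit, Matrix.nonsing_inv_mul _ hdB.ne'.isUnit]
  have hN : 0 < T φ := by
    rw [hTφ]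
    have : 0 < Fintype.card ι := Fintype.card_pos
    positivity
  have hTlin : ∀ ψ, T ψ = T φ * ℓ ψ := by
    intro ψ
    -- Subtracting ℓ(ψ)φ projects onto the kernel of ℓ, so T is a multiple of ℓ; evaluating at φ
    -- identifies the multiplier as T φ.
    have h := hcrit (ψ - ℓ ψ • φ) (by simp [hℓφ])
    simp only [hT, map_sub, map_smul, mul_sub, Matrix.mul_smul, Matrix.trace_sub,
      Matrix.trace_smul, smul_eq_mul] at h ⊢
    linarith
  -- Inverses scale by (T φ)⁻¹, which cancels the multiplier.
  refine ⟨T φ • φ, ?_, ?_, fun ψ => ?_⟩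
  · rw [map_smul]; exact hPA.smul hN
  · rw [map_smul]; exact hPB.smul hN
  · have hinvA : (T φ • A φ)⁻¹ = (T φ)⁻¹ • (A φ)⁻¹ := by
      refine Matrix.inv_eq_left_inv ?_
      rw [smul_mul_smul_comm, Matrix.nonsing_inv_mul _ hdA.ne'.isUnit, inv_mul_cancel₀ hN.ne',
        one_smul]
    have hinvB : (T φ • B φ)⁻¹ = (T φ)⁻¹ • (B φ)⁻¹ := by
      refine Matrix.inv_eq_left_inv ?_
      rw [smul_mul_smul_comm, Matrix.nonsing_inv_mul _ hdB.ne'.isUnit, inv_mul_cancel₀ hN.ne',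
        one_smul]
    rw [map_smul, map_smul, hinvA, hinvB, Matrix.smul_mul, Matrix.smul_mul, Matrix.trace_smul,
      Matrix.trace_smul, ← smul_add]
    change (T φ)⁻¹ • T ψ = _
    rw [hTlin ψ, smul_eq_mul, inv_mul_cancel_left₀ hN.ne']

end Matrix

/-! ### No cancellation of top degrees in sums of squares -/

section Degree

theorem leadingCoeff_nonneg_of_eval_nonneg {a : Polynomial ℝ} (h : ∀ x, 0 ≤ a.eval x) :
    0 ≤ a.leadingCoeff := by
  by_contra! hneg
  by_cases hd : 0 < a.degree
  · have ht := a.tendsto_atBot_of_leadingCoeff_nonpos hd hneg.le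
    obtain ⟨x, hx⟩ := (ht.eventually (eventually_lt_atBot 0)).exists
    exact absurd (h x) (not_le.2 hx)
  · rw [Polynomial.eq_C_of_degree_le_zero (not_lt.1 hd)] at h hneg
    have := h 0
    simp at this hneg
    linarith

/-- Both leading coefficients are nonnegative, so they cannot cancel. -/
theorem natDegree_le_natDegree_add_of_eval_nonneg {a b : Polynomial ℝ} (ha : ∀ x, 0 ≤ a.eval x)
    (hb : ∀ x, 0 ≤ b.eval x) : a.natDegree ≤ (a + b).natDegree := by
  by_cases h0 : a.leadingCoeff + b.leadingCoeff = 0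
  · have := leadingCoeff_nonneg_of_eval_nonneg ha
    have := leadingCoeff_nonneg_of_eval_nonneg hb
    have h1 : a.leadingCoeff = 0 := by linarith
    simp [Polynomial.leadingCoeff_eq_zero.1 h1]
  · refine Polynomial.natDegree_le_natDegree ?_
    rw [Polynomial.degree_add_eq_of_leadingCoeff_add_ne_zero h0]
    exact le_max_left _ _

variable {σ : Type*}

/-- The restriction of a polynomial to the line through the origin and `x`. -/
def lineRestrict (x : σ → ℝ) : MvPolynomial σ ℝ →ₐ[ℝ] Polynomial ℝ :=
  aeval fun i => Polynomial.C (x i) * Polynomial.X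

theorem eval_lineRestrict (x : σ → ℝ) (a : MvPolynomial σ ℝ) (s : ℝ) :
    (lineRestrict x a).eval s = eval (fun i => x i * s) a := by
  induction a using MvPolynomial.induction_on with
  | C r => simp [lineRestrict, Polynomial.algebraMap_eq]
  | add p q hp hq => simp [hp, hq]
  | mul_X p i hp => rw [map_mul, Polynomial.eval_mul, hp]; simp [lineRestrict]

/-- This lets the total degree be read off from restrictions to lines, reducing degree claims to one
variable. -/
theorem coeff_lineRestrict (x : σ → ℝ) (a : MvPolynomial σ ℝ) (k : ℕ) :
    (lineRestrict x a).coeff k = eval x (homogeneousComponent k a) := by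
  classical
  induction a using MvPolynomial.induction_on' with
  | add p q hp hq => simp [hp, hq]
  | monomial d r =>
    have h1 : lineRestrict x (monomial d r) =
        Polynomial.C (eval x (monomial d r)) * Polynomial.X ^ d.degree := by
      rw [lineRestrict, aeval_monomial, eval_monomial]
      simp only [mul_pow, Finsupp.prod_mul, Polynomial.algebraMap_eq, Polynomial.C_mul, mul_assoc]
      congr 2
      · simp [Finsupp.prod]
      · simp [Finsupp.prod, Finset.prod_pow_eq_pow_sum, Finsupp.degree_apply]
    have h2 : homogeneousComponent k (monomial d r) =
        if k = d.degree then monomial d r else 0 := by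
      ext e
      rw [coeff_homogeneousComponent]
      by_cases hde : d = e
      · subst hde
        by_cases hk : k = d.degree
        · simp [hk]
        · rw [if_neg hk, if_neg (Ne.symm hk), coeff_zero]
      · split_ifs <;> simp [coeff_monomial, hde]
    rw [h1, h2, Polynomial.coeff_C_mul_X_pow]
    split_ifs <;> simp

theorem natDegree_lineRestrict_le (x : σ → ℝ) (a : MvPolynomial σ ℝ) :
    (lineRestrict x a).natDegree ≤ a.totalDegree := by
  rw [Polynomial.natDegree_le_iff_coeff_eq_zero]
  intro k hk
  rw [coeff_lineRestrict, homogeneousComponent_eq_zero _ _ hk, map_zero]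

theorem totalDegree_le_iff_degree {a : MvPolynomial σ ℝ} {d : ℕ} :
    a.totalDegree ≤ d ↔ ∀ α : σ →₀ ℕ, d < α.degree → a.coeff α = 0 := by
  constructor
  · intro h α hα
    exact coeff_eq_zero_of_totalDegree_lt (h.trans_lt hα)
  · intro h
    refine Finset.sup_le fun α hα => ?_
    by_contra! hlt
    exact mem_support_iff.1 hα (h α hlt)

theorem totalDegree_le_of_natDegree_lineRestrict_le {a : MvPolynomial σ ℝ} {d : ℕ}
    (h : ∀ x, (lineRestrict x a).natDegree ≤ d) : a.totalDegree ≤ d := by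
  rw [totalDegree_le_iff_degree]
  intro α hα
  have h0 : homogeneousComponent α.degree a = 0 := by
    refine MvPolynomial.funext fun x => ?_
    rw [← coeff_lineRestrict, map_zero]
    exact Polynomial.coeff_eq_zero_of_natDegree_lt ((h x).trans_lt hα)
  have := congrArg (coeff α) h0
  classical
  rwa [coeff_homogeneousComponent, if_pos rfl, coeff_zero] at this

theorem totalDegree_le_totalDegree_add_of_eval_nonneg {a b : MvPolynomial σ ℝ}
    (ha : ∀ x, 0 ≤ eval x a) (hb : ∀ x, 0 ≤ eval x b) : a.totalDegree ≤ (a + b).totalDegree := by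
  refine totalDegree_le_of_natDegree_lineRestrict_le fun x => ?_
  refine (natDegree_le_natDegree_add_of_eval_nonneg (b := lineRestrict x b)
    (fun s => ?_) (fun s => ?_)).trans ?_
  · rw [eval_lineRestrict]; exact ha _
  · rw [eval_lineRestrict]; exact hb _
  · rw [← map_add]; exact natDegree_lineRestrict_le x _

theorem eval_nonneg_of_isSumSq {a : MvPolynomial σ ℝ} (ha : IsSumSq a) (x : σ → ℝ) :
    0 ≤ eval x a := by
  induction ha with
  | zero => simp
  | sq_add b _ ih => rw [map_add, map_mul]; exact add_nonneg (mul_self_nonneg _) ih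

theorem totalDegree_le_of_mul_self_le {a : MvPolynomial σ ℝ} {d : ℕ}
    (h : (a * a).totalDegree ≤ 2 * d) : a.totalDegree ≤ d := by
  by_cases ha : a = 0
  · simp [ha]
  · rw [totalDegree_mul_of_isDomain ha ha] at h
    omega

/-- A functional which is nonnegative on squares of polynomials of degree at most `d` is
nonnegative on sums of squares of degree at most `2d`. -/
theorem nonneg_of_isSumSq (L : MvPolynomial σ ℝ →ₗ[ℝ] ℝ) {d : ℕ}
    (hL : ∀ a : MvPolynomial σ ℝ, a.totalDegree ≤ d → 0 ≤ L (a * a)) {s : MvPolynomial σ ℝ}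
    (hs : IsSumSq s) (hd : s.totalDegree ≤ 2 * d) : 0 ≤ L s := by
  induction hs with
  | zero => simp
  | @sq_add a s hs ih =>
    have ha : ∀ x, 0 ≤ eval x (a * a) := eval_nonneg_of_isSumSq (IsSumSq.mul_self a)
    have hs' : ∀ x, 0 ≤ eval x s := eval_nonneg_of_isSumSq hs
    have h1 := (totalDegree_le_totalDegree_add_of_eval_nonneg ha hs').trans hd
    have h2 : s.totalDegree ≤ 2 * d := by
      refine (totalDegree_le_totalDegree_add_of_eval_nonneg hs' ha).trans ?_
      rwa [add_comm]
    rw [map_add]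
    exact add_nonneg (hL a (totalDegree_le_of_mul_self_le h1)) (ih h2)

end Degree

/-! ### Moment matrices as quadratic forms -/

section Moment

variable {n : ℕ}

/-- The polynomial with coefficient vector `c`. -/
def polyOfVec (d : ℕ) (c : Idx n d → ℝ) : MvPolynomial (Fin n) ℝ :=
  ∑ α : Idx n d, monomial α.1 (c α)

theorem coeff_polyOfVec {d : ℕ} (c : Idx n d → ℝ) (α : Idx n d) :
    (polyOfVec d c).coeff α.1 = c α := by
  classical
  simp [polyOfVec, coeff_sum, coeff_monomial, Subtype.coe_inj]

theorem totalDegree_polyOfVec_le {d : ℕ} (c : Idx n d → ℝ) :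
    (polyOfVec d c).totalDegree ≤ d := by
  classical
  rw [totalDegree_le_iff_degree]
  intro α hα
  rw [polyOfVec, coeff_sum]
  refine Finset.sum_eq_zero fun β _ => ?_
  rw [coeff_monomial, if_neg]
  rintro rfl
  exact absurd β.2 (not_le.2 hα)

theorem polyOfVec_ne_zero {d : ℕ} {c : Idx n d → ℝ} (hc : c ≠ 0) : polyOfVec d c ≠ 0 := by
  intro h
  apply hc
  funext α
  rw [← coeff_polyOfVec c α, h]
  simp

theorem coeffVec_injOn {d : ℕ} {a b : MvPolynomial (Fin n) ℝ} (ha : a.totalDegree ≤ d)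
    (hb : b.totalDegree ≤ d) (h : coeffVec d a = coeffVec d b) : a = b := by
  ext α
  by_cases hα : α.degree ≤ d
  · exact congrFun h ⟨α, hα⟩
  · push Not at hα
    rw [totalDegree_le_iff_degree.1 ha α hα, totalDegree_le_iff_degree.1 hb α hα]

theorem coeffVec_polyOfVec {d : ℕ} (c : Idx n d → ℝ) : coeffVec d (polyOfVec d c) = c :=
  funext fun α => coeff_polyOfVec c α

theorem polyOfVec_coeffVec {d : ℕ} {a : MvPolynomial (Fin n) ℝ} (ha : a.totalDegree ≤ d) :
    polyOfVec d (coeffVec d a) = a :=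
  coeffVec_injOn (totalDegree_polyOfVec_le _) ha (coeffVec_polyOfVec _)

theorem dotProduct_momentMatrix_mulVec (s : ℕ) (L : MvPolynomial (Fin n) ℝ →ₗ[ℝ] ℝ)
    (c : Idx n s → ℝ) :
    c ⬝ᵥ momentMatrix s L *ᵥ c = L (polyOfVec s c * polyOfVec s c) := by
  rw [polyOfVec, Finset.sum_mul_sum]
  simp only [map_sum, monomial_mul, dotProduct, Matrix.mulVec, Finset.mul_sum]
  refine Finset.sum_congr rfl fun α _ => Finset.sum_congr rfl fun β _ => ?_
  have : monomial (α.1 + β.1) (c α * c β) = (c α * c β) • monomial (α.1 + β.1) (1 : ℝ) := by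
    rw [smul_monomial, smul_eq_mul, mul_one]
  rw [this, map_smul, momentMatrix, Matrix.of_apply, smul_eq_mul]
  ring

theorem isHermitian_momentMatrix (s : ℕ) (L : MvPolynomial (Fin n) ℝ →ₗ[ℝ] ℝ) :
    (momentMatrix s L).IsHermitian := by
  ext α β
  simp [momentMatrix, add_comm]

theorem momentMatrix_nonneg {s : ℕ} {L : MvPolynomial (Fin n) ℝ →ₗ[ℝ] ℝ}
    (h : (momentMatrix s L).PosSemidef) {a : MvPolynomial (Fin n) ℝ} (ha : IsSumSq a)
    (hd : a.totalDegree ≤ 2 * s) : 0 ≤ L a := by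
  refine nonneg_of_isSumSq L (fun b hb => ?_) ha hd
  have := h.dotProduct_mulVec_nonneg (coeffVec s b)
  rwa [star_trivial, dotProduct_momentMatrix_mulVec, polyOfVec_coeffVec hb] at this

theorem momentMatrix_posDef {s : ℕ} {L : MvPolynomial (Fin n) ℝ →ₗ[ℝ] ℝ}
    (h : ∀ a : MvPolynomial (Fin n) ℝ, a ≠ 0 → a.totalDegree ≤ s → 0 < L (a * a)) :
    (momentMatrix s L).PosDef := by
  refine .of_dotProduct_mulVec_pos (isHermitian_momentMatrix s L) fun c hc => ?_
  rw [star_trivial, dotProduct_momentMatrix_mulVec]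
  exact h _ (polyOfVec_ne_zero hc) (totalDegree_polyOfVec_le c)

theorem riesz_apply {d : ℕ} (φ : Idx n d → ℝ) (a : MvPolynomial (Fin n) ℝ) :
    riesz φ a = ∑ α : Idx n d, φ α * a.coeff α.1 := by
  simp [riesz, LinearMap.sum_apply, lcoeff]

/-- The moment vector of the Dirac measure at `x` represents the evaluation at `x`. -/
theorem riesz_monVec {d : ℕ} (x : Fin n → ℝ) {a : MvPolynomial (Fin n) ℝ}
    (ha : a.totalDegree ≤ d) : riesz (monVec d x) a = eval x a := by
  conv_rhs => rw [← polyOfVec_coeffVec ha, polyOfVec, map_sum]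
  rw [riesz_apply]
  refine Finset.sum_congr rfl fun α _ => ?_
  simp [monVec, coeffVec, eval_monomial, mul_comm]

/-- The map sending a moment vector to the moment matrix localized at `g`. -/
def localizedMomentMatrix (s d : ℕ) (g : MvPolynomial (Fin n) ℝ) :
    (Idx n d → ℝ) →ₗ[ℝ] Matrix (Idx n s) (Idx n s) ℝ where
  toFun φ := momentMatrix s (localize g (riesz φ))
  map_add' φ ψ := by
    ext α β
    simp [momentMatrix, localize, riesz_apply, add_mul, Finset.sum_add_distrib]
  map_smul' c φ := by
    ext α β
    simp [momentMatrix, localize, riesz_apply, mul_assoc, Finset.mul_sum]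

theorem localizedMomentMatrix_apply (s d : ℕ) (g : MvPolynomial (Fin n) ℝ) (φ : Idx n d → ℝ) :
    localizedMomentMatrix s d g φ = momentMatrix s (localize g (riesz φ)) := rfl

theorem localize_one (L : MvPolynomial (Fin n) ℝ →ₗ[ℝ] ℝ) : localize 1 L = L := by
  ext; simp [localize]

/-- The degree bound keeps every entry g·x^(α+β) in the range where the truncated functional is
still evaluation at x. -/
theorem localizedMomentMatrix_monVec {s d : ℕ} {g : MvPolynomial (Fin n) ℝ}
    (hd : g.totalDegree + 2 * s ≤ d) (x : Fin n → ℝ) :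
    localizedMomentMatrix s d g (monVec d x) =
      eval x g • Matrix.vecMulVec (monVec s x) (monVec s x) := by
  ext α β
  have hdeg : (g * monomial (α.1 + β.1) (1 : ℝ)).totalDegree ≤ d := by
    refine (totalDegree_mul _ _).trans (le_trans ?_ hd)
    gcongr
    refine (totalDegree_monomial_le _ _).trans ?_
    change (α.1 + β.1).degree ≤ _
    rw [map_add]
    have := α.2
    have := β.2
    omega
  have hm : monomial (α.1 + β.1) (1 : ℝ) = monomial α.1 1 * monomial β.1 1 := by
    rw [monomial_mul, one_mul]
  rw [localizedMomentMatrix_apply, momentMatrix, Matrix.of_apply, localize, LinearMap.comp_apply,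
    LinearMap.mulLeft_apply, riesz_monVec x hdeg, hm, map_mul, map_mul]
  simp [Matrix.vecMulVec_apply, monVec]

end Moment

/-! ### Feasibility, compactness and the Christoffel identity -/

section Duality

variable {n : ℕ}

theorem isSumSq_of_mem_intSosCone {s : ℕ} {p : MvPolynomial (Fin n) ℝ}
    (hp : p ∈ intSosCone n s) : IsSumSq p := by
  obtain ⟨a, ⟨ha, hd⟩, he⟩ := interior_subset hp.2
  rwa [← coeffVec_injOn hd hp.1 he]

theorem exists_add_monomial_mem_sosCone {s : ℕ} {p : MvPolynomial (Fin n) ℝ}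
    (hp : p ∈ intSosCone n s) :
    ∃ ε > 0, ∀ (γ : Idx n (2 * s)) (r : ℝ), |r| ≤ ε → p + monomial γ.1 r ∈ sosCone n s := by
  classical
  obtain ⟨δ, hδ, hball⟩ := Metric.mem_nhds_iff.1 (mem_interior_iff_mem_nhds.1 hp.2)
  -- Half the radius, because the ball is open and |r| = ε is allowed.
  refine ⟨δ / 2, by positivity, fun γ r hr => ?_⟩
  have hdeg : (p + monomial γ.1 r).totalDegree ≤ 2 * s :=
    (totalDegree_add _ _).trans (max_le hp.1 ((totalDegree_monomial_le _ _).trans γ.2))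
  have hv : coeffVec (2 * s) (p + monomial γ.1 r) = coeffVec (2 * s) p + Pi.single γ r := by
    funext α
    simp [coeffVec, coeff_monomial, Pi.single_apply, Subtype.ext_iff, eq_comm]
  obtain ⟨a, ha, he⟩ := hball (show coeffVec (2 * s) (p + monomial γ.1 r) ∈ _ by
    rw [hv, Metric.mem_ball, dist_eq_norm, add_sub_cancel_left, Pi.norm_single, Real.norm_eq_abs]
    linarith)
  rwa [← coeffVec_injOn ha.2 hdeg he]

theorem riesz_monomial {d : ℕ} (φ : Idx n d → ℝ) (γ : Idx n d) (r : ℝ) :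
    riesz φ (monomial γ.1 r) = r * φ γ := by
  classical
  simp [riesz_apply, coeff_monomial, Subtype.coe_inj, mul_comm]

theorem riesz_C {d : ℕ} (φ : Idx n d → ℝ) (c : ℝ) :
    riesz φ (C c) = c * φ ⟨0, by simp⟩ :=
  riesz_monomial φ ⟨0, by simp⟩ c

theorem riesz_sum_monVec {d : ℕ} (s : Finset (Fin n → ℝ)) {a : MvPolynomial (Fin n) ℝ}
    (ha : a.totalDegree ≤ d) : riesz (∑ x ∈ s, monVec d x) a = ∑ x ∈ s, eval x a := by
  simp_rw [← riesz_monVec _ ha, riesz_apply, Finset.sum_apply, Finset.sum_mul]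
  exact Finset.sum_comm

/-- A set with nonempty interior contains finite grids on which no nonzero polynomial of bounded
degree vanishes. -/
theorem exists_finset_forall_eval_eq_zero {S : Set (Fin n → ℝ)} (hS : (interior S).Nonempty)
    (d : ℕ) : ∃ s : Finset (Fin n → ℝ), s.Nonempty ∧ ↑s ⊆ S ∧
      ∀ a : MvPolynomial (Fin n) ℝ, a.totalDegree ≤ d → (∀ x ∈ s, eval x a = 0) → a = 0 := by
  classical
  obtain ⟨x₀, hx₀⟩ := hS
  obtain ⟨δ, hδ, hball⟩ := Metric.mem_nhds_iff.1 (mem_interior_iff_mem_nhds.1 hx₀)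
  have hinf : ∀ i, (Metric.ball (x₀ i) δ).Infinite := by
    intro i
    rw [Real.ball_eq_Ioo]
    exact Set.Ioo_infinite (by linarith)
  -- One point more per coordinate than the degree allowed in each variable.
  choose F hF hcard using fun i => (hinf i).exists_subset_card_eq (d + 1)
  refine ⟨Fintype.piFinset F, ?_, fun x hx => hball ?_, fun a ha h => ?_⟩
  · rw [Fintype.piFinset_nonempty]
    intro i
    rw [← Finset.card_pos, hcard]
    omega
  · rw [Finset.mem_coe, Fintype.mem_piFinset] at hx
    rw [ball_pi _ hδ]
    exact fun i _ => hF i (hx i)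
  · refine eq_zero_of_eval_zero_at_prod_finset a F (fun i => ?_) fun x hx =>
      h x (Fintype.mem_piFinset.2 hx)
    rw [hcard]
    exact Nat.lt_succ_of_le ((degreeOf_le_totalDegree a i).trans ha)

/-- Degrees add in a product with g ≠ 0, so σ₁ has degree at most 2r and the localized matrix
controls it. -/
theorem mem_dualCone_of_posSemidef {t r : ℕ} {g : MvPolynomial (Fin n) ℝ} (hg : g ≠ 0)
    (hr : 2 * t ≤ g.totalDegree + 2 * r) {φ : Idx n (2 * t) → ℝ}
    (hA : (momentMatrix t (riesz φ)).PosSemidef)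
    (hB : (momentMatrix r (localize g (riesz φ))).PosSemidef) : φ ∈ dualCone t g := by
  rintro _ ⟨σ₀, σ₁, h₀, h₁, hd₀, hd₁, rfl⟩
  rw [map_add]
  refine add_nonneg (momentMatrix_nonneg hA h₀ hd₀) ?_
  have hd : σ₁.totalDegree ≤ 2 * r := by
    by_cases hσ : σ₁ = 0
    · simp [hσ]
    · rw [totalDegree_mul_of_isDomain hσ hg] at hd₁
      omega
  rw [mul_comm σ₁ g]
  exact momentMatrix_nonneg hB h₁ hd

theorem exists_posDef_momentMatrix {t r : ℕ} {g : MvPolynomial (Fin n) ℝ} (hg : g ≠ 0)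
    (hr : g.totalDegree + 2 * r ≤ 2 * t)
    (hS : (interior {x : Fin n → ℝ | 0 ≤ eval x g}).Nonempty) :
    ∃ φ : Idx n (2 * t) → ℝ, (momentMatrix t (riesz φ)).PosDef ∧
      (momentMatrix r (localize g (riesz φ))).PosDef ∧ 0 < φ ⟨0, by simp⟩ := by
  obtain ⟨s, hne, hsub, hs⟩ := exists_finset_forall_eval_eq_zero hS (2 * t)
  refine ⟨∑ x ∈ s, monVec (2 * t) x, momentMatrix_posDef fun a ha hd => ?_,
    momentMatrix_posDef fun a ha hd => ?_, ?_⟩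
  · have hdeg : (a * a).totalDegree ≤ 2 * t := (totalDegree_mul _ _).trans (by omega)
    rw [riesz_sum_monVec s hdeg]
    have hnn : ∀ x ∈ s, 0 ≤ eval x (a * a) := fun x _ =>
      eval_nonneg_of_isSumSq (IsSumSq.mul_self a) x
    refine (Finset.sum_nonneg hnn).lt_of_ne' fun h0 => ha (hs a (by omega) fun x hx => ?_)
    simpa using (Finset.sum_eq_zero_iff_of_nonneg hnn).1 h0 x hx
  · have hdeg : (g * (a * a)).totalDegree ≤ 2 * t := by
      refine (totalDegree_mul _ _).trans ?_
      have := totalDegree_mul a a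
      omega
    rw [localize, LinearMap.comp_apply, LinearMap.mulLeft_apply, riesz_sum_monVec s hdeg]
    have hnn : ∀ x ∈ s, 0 ≤ eval x (g * (a * a)) := fun x hx => by
      rw [map_mul]
      exact mul_nonneg (hsub hx) (eval_nonneg_of_isSumSq (IsSumSq.mul_self a) x)
    -- The grid may meet the zero set of g, so the vanishing argument is applied to g·a rather than
    -- to a.
    have hga : (g * a).totalDegree ≤ 2 * t := (totalDegree_mul _ _).trans (by omega)
    refine (Finset.sum_nonneg hnn).lt_of_ne' fun h0 =>
      mul_ne_zero hg ha (hs (g * a) hga fun x hx => ?_)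
    simpa using (Finset.sum_eq_zero_iff_of_nonneg hnn).1 h0 x hx
  · have h := riesz_sum_monVec s (a := (C 1 : MvPolynomial (Fin n) ℝ)) (d := 2 * t) (by simp)
    rw [riesz_C, one_mul] at h
    rw [h]
    simpa using hne

/-- Since φ(gq) ≥ 0, φ(p) ≤ c; and φ(p ± ε x^γ) ≥ 0 then gives ε|φ_γ| ≤ φ(p) ≤ c. -/
theorem isBounded_setOf_posSemidef {t r : ℕ} {g p q : MvPolynomial (Fin n) ℝ} {c : ℝ}
    (hp : p ∈ intSosCone n t) (hq : q ∈ intSosCone n r) (h : p + g * q = C c) :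
    Bornology.IsBounded {φ : Idx n (2 * t) → ℝ | (momentMatrix t (riesz φ)).PosSemidef ∧
      (momentMatrix r (localize g (riesz φ))).PosSemidef ∧ φ ⟨0, by simp⟩ = 1} := by
  obtain ⟨ε, hε, hmem⟩ := exists_add_monomial_mem_sosCone hp
  refine Metric.isBounded_closedBall (x := 0) (r := |c| / ε) |>.subset fun φ ⟨hA, hB, h1⟩ => ?_
  rw [mem_closedBall_zero_iff, pi_norm_le_iff_of_nonneg (by positivity)]
  intro γ
  have hgq : 0 ≤ riesz φ (g * q) := momentMatrix_nonneg hB (isSumSq_of_mem_intSosCone hq) hq.1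
  have hc := congrArg (riesz φ) h
  rw [map_add, riesz_C, h1, mul_one] at hc
  have key : ∀ r : ℝ, |r| ≤ ε → 0 ≤ riesz φ p + r * φ γ := by
    intro r hr
    rw [← riesz_monomial, ← map_add]
    exact momentMatrix_nonneg hA (hmem γ r hr).1 (hmem γ r hr).2
  have h2 := key ε (abs_of_pos hε).le
  have h3 := key (-ε) (by rw [abs_neg, abs_of_pos hε])
  rw [Real.norm_eq_abs, le_div_iff₀ hε]
  have h4 : |φ γ * ε| ≤ c := abs_le.2 ⟨by linarith, by linarith⟩
  rw [abs_mul, abs_of_pos hε] at h4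
  exact h4.trans (le_abs_self c)

theorem trace_inv_mul_smul_vecMulVec {ι : Type*} [Fintype ι] [DecidableEq ι] (M : Matrix ι ι ℝ)
    (c : ℝ) (v : ι → ℝ) :
    (M⁻¹ * c • Matrix.vecMulVec v v).trace = c * (v ⬝ᵥ M⁻¹ *ᵥ v) := by
  rw [Matrix.mul_smul, Matrix.trace_smul, Matrix.mul_vecMulVec, Matrix.trace_vecMulVec,
    smul_eq_mul, dotProduct_comm]

theorem exists_christoffelPoly_add_eq_one {t r : ℕ} {g p q : MvPolynomial (Fin n) ℝ} {c : ℝ}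
    (hg : g ≠ 0) (hr : g.totalDegree + 2 * r = 2 * t)
    (hS : (interior {x : Fin n → ℝ | 0 ≤ eval x g}).Nonempty)
    (hp : p ∈ intSosCone n t) (hq : q ∈ intSosCone n r) (h : p + g * q = C c) :
    ∃ φ : Idx n (2 * t) → ℝ, φ ∈ interior (dualCone t g) ∧ (momentMatrix t (riesz φ)).PosDef ∧
      (momentMatrix r (localize g (riesz φ))).PosDef ∧
      ∀ x : Fin n → ℝ, 1 = christoffelPoly t (riesz φ) x +
        eval x g * christoffelPoly r (localize g (riesz φ)) x := by
  have : Nonempty (Idx n t) := ⟨⟨0, by simp⟩⟩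
  have hA : ∀ φ : Idx n (2 * t) → ℝ,
      localizedMomentMatrix t (2 * t) 1 φ = momentMatrix t (riesz φ) := fun φ => by
    rw [localizedMomentMatrix_apply, localize_one]
  have hB : ∀ φ : Idx n (2 * t) → ℝ,
      localizedMomentMatrix r (2 * t) g φ = momentMatrix r (localize g (riesz φ)) := fun φ => rfl
  obtain ⟨φ₀, hA₀, hB₀, h₀⟩ := exists_posDef_momentMatrix hg hr.le hS
  obtain ⟨φ, hφA, hφB, hφ⟩ := exists_posDef_trace_eq (localizedMomentMatrix t (2 * t) 1)
    (localizedMomentMatrix r (2 * t) g)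
    (LinearMap.proj (R := ℝ) (φ := fun _ : Idx n (2 * t) => ℝ) ⟨0, by simp⟩)
    (fun φ => isHermitian_momentMatrix _ _) (fun φ => isHermitian_momentMatrix _ _)
    (by simpa only [hA, hB, LinearMap.proj_apply] using isBounded_setOf_posSemidef hp hq h)
    ((hA φ₀).symm ▸ hA₀) hB₀ h₀
  refine ⟨φ, ?_, hA φ ▸ hφA, hφB, fun x => ?_⟩
  -- Definiteness of both matrices is an open condition that implies membership in the dual cone.
  · refine mem_interior.2 ⟨_, ?_, ((isOpen_setOf_posDef
      (localizedMomentMatrix t (2 * t) 1).continuous_of_finiteDimensional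
      fun _ => isHermitian_momentMatrix _ _).inter (isOpen_setOf_posDef
      (localizedMomentMatrix r (2 * t) g).continuous_of_finiteDimensional
      fun _ => isHermitian_momentMatrix _ _)), hφA, hφB⟩
    rintro ψ ⟨h1, h2⟩
    exact mem_dualCone_of_posSemidef hg hr.ge (hA ψ ▸ Matrix.PosDef.posSemidef h1)
      (Matrix.PosDef.posSemidef h2)
  · have hx := hφ (monVec (2 * t) x)
    rw [localizedMomentMatrix_monVec (by simp), localizedMomentMatrix_monVec hr.le,
      trace_inv_mul_smul_vecMulVec, trace_inv_mul_smul_vecMulVec, hA, hB, map_one, one_mul] at hx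
    rw [christoffelPoly, christoffelPoly, hx]
    simp [monVec]

end Duality

end Pell

end

theorem lemma2p9 (n t : ℕ) (g : MvPolynomial (Fin n) ℝ) (hg : g ≠ 0)
    (hgeven : Even g.totalDegree) (ht : Pell.halfDeg g ≤ t)
    (hS : (interior {x : Fin n → ℝ | 0 ≤ MvPolynomial.eval x g}).Nonempty) :
    (∀ p q : MvPolynomial (Fin n) ℝ,
      p ∈ Pell.intSosCone n t → q ∈ Pell.intSosCone n (t - Pell.halfDeg g) →
      p + g * q = 1 →
      ∃ φ : Pell.Idx n (2 * t) → ℝ,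
        φ ∈ interior (Pell.dualCone t g) ∧
        (Pell.momentMatrix t (Pell.riesz φ)).PosDef ∧
        (Pell.momentMatrix (t - Pell.halfDeg g) (Pell.localize g (Pell.riesz φ))).PosDef ∧
        ∀ x : Fin n → ℝ,
          1 = Pell.christoffelPoly t (Pell.riesz φ) x +
            MvPolynomial.eval x g *
              Pell.christoffelPoly (t - Pell.halfDeg g) (Pell.localize g (Pell.riesz φ)) x) ∧
    (∀ (I : Type) [Fintype I] (C H : I → MvPolynomial (Fin n) ℤ),
      (∀ i, MvPolynomial.map (Int.castRingHom ℝ) (C i) ^ 2 +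
        g * MvPolynomial.map (Int.castRingHom ℝ) (H i) ^ 2 = 1) →
      ∑ i, MvPolynomial.map (Int.castRingHom ℝ) (C i) ^ 2 ∈ Pell.intSosCone n t →
      ∑ i, MvPolynomial.map (Int.castRingHom ℝ) (H i) ^ 2 ∈
        Pell.intSosCone n (t - Pell.halfDeg g) →
      ∃ φ : Pell.Idx n (2 * t) → ℝ,
        φ ∈ interior (Pell.dualCone t g) ∧
        (Pell.momentMatrix t (Pell.riesz φ)).PosDef ∧
        (Pell.momentMatrix (t - Pell.halfDeg g) (Pell.localize g (Pell.riesz φ))).PosDef ∧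
        ∀ x : Fin n → ℝ,
          1 = Pell.christoffelPoly t (Pell.riesz φ) x +
            MvPolynomial.eval x g *
              Pell.christoffelPoly (t - Pell.halfDeg g) (Pell.localize g (Pell.riesz φ)) x) := by
  -- Even degree gives equality: ≤ keeps the localized entries within degree 2t, ≥ makes the
  -- localized matrix cover every admissible σ₁.
  have hr : g.totalDegree + 2 * (t - Pell.halfDeg g) = 2 * t := by
    obtain ⟨k, hk⟩ := hgeven
    rw [Pell.halfDeg] at ht ⊢
    omega
  refine ⟨fun p q hp hq h => ?_, fun I _ C H h hC hH => ?_⟩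
  · exact Pell.exists_christoffelPoly_add_eq_one (c := 1) hg hr hS hp hq (by simpa using h)
  · refine Pell.exists_christoffelPoly_add_eq_one (c := Fintype.card I) hg hr hS hC hH ?_
    rw [Finset.mul_sum, ← Finset.sum_add_distrib, Finset.sum_congr rfl fun i _ => h i]
    simp
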